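/- Let $G=(V,E)$ be a finite simple graph with $V\neq\emptyset$ and maximum degree $\Delta$, let $w\in(0,1)$ and let $M\subseteq E$ be arbitrary. For $A\subseteq E$ let $\partial A$ be the set of vertices of odd degree in $A$, let $\mathcal C_k=\{A\subseteq E: |\partial A|=k\}$, and let $\lambda(A)=w^{|A\oplus M|}$ and $\lambda(\mathcal S)=\sum_{A\in\mathcal S}\lambda(A)$, where $\oplus$ is the symmetric difference. On $\mathcal W=\mathcal C_0\cup\mathcal C_2$ let $\pi$ be the Prokof'ev--Svistunov measure $$\pi(A)=\frac{\Psi(A)\lambda(A)}{|V|\lambda(\mathcal C_0)+2\lambda(\mathcal C_2)},\qquad \Psi=|V|\text{ on }\mathcal C_0,\quad \Psi=2\text{ on }\mathcal C_2 .$$ The worm process is the Metropolis chain on $\mathcal W$ with target $\pi$ and the following proposals: from $A\in\mathcal C_0$ choose $v\in V$ uniformly, from $A\in\mathcal C_2$ choose $v\in\partial A$ uniformly; then choose a neighbour $u$ of $v$ uniformly and propose $A\oplus\{uv\}$ (if $v$ is isolated, stay at $A$). The lazy worm process, with transition matrix $P$, does nothing with probability $1/2$ at every step and otherwise makes a step of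 the worm process. A set of canonical paths $\Gamma=\{\gamma_{I,F}: I\in\mathcal W,\ F\in\mathcal C_0\}$ consists of a path $\gamma_{I,F}$ from $I$ to $F$, without repeated states, in the transition graph $\mathscr T=\{(x,y): P(x,y)>0\}$, for each such pair. Its congestion is $$\varphi(\Gamma)=\max_{t=(x,y)\in\mathscr T}\ \frac{1}{\pi(x)P(x,y)}\sum_{(I,F):\, t\in\gamma_{I,F}}\pi(I)\pi(F).$$ The relaxation time $t_{\rm rel}$ is the maximum of $1/(1-|\mu|)$ over the eigenvalues $\mu\ne1$ of $P$ (and $0$ if there is only one state). **Theorem.** Suppose that the model has $(\chi_2,\chi_4)$-bounded defect susceptibility, that is, $\lambda(\mathcal C_2)/\lambda(\mathcal C_0)\le\chi_2$ and $\lambda(\mathcal C_4)/\lambda(\mathcal C_0)\le\chi_4$ with real $\chi_2,\chi_4$. Then there is a set $\Gamma$ of canonical paths from $\mathcal W$ to $\mathcal C_0$, all of length at most $|E|$, such that both $\varphi(\Gamma)$ and the normalized congestion $\varphi(\Gamma)/\pi(\mathcal C_0)$ are at most $$2\Delta w^{-1}\left[(1+\chi_2)(2+|V|)+2\chi_4\right].$$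 Moreover $$t_{\rm rel}\le 8\Delta w^{-1}|E|\left[(1+\chi_2)(2+|V|)+2\chi_4\right].$$ -/

import Mathlib

open scoped symmDiff

noncomputable section

/-! ### Finite Markov chains -/

namespace MarkovChain

variable {Ω : Type*} [Fintype Ω] [DecidableEq Ω]

/-- The Metropolis chain with proposal probabilities `K` and target measure `π`: a proposed move
`x → y` with `y ≠ x` is accepted with probability `min (1, π y K(y,x) / (π x K(x,y)))`, and
otherwise the chain stays at `x`. -/
def metropolis (K : Matrix Ω Ω ℝ) (π : Ω → ℝ) : Matrix Ω Ω ℝ :=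
  let move : Ω → Ω → ℝ := fun x y => K x y * min 1 (π y * K y x / (π x * K x y))
  Matrix.of fun x y => if x = y then 1 - ∑ z ∈ Finset.univ.erase x, move x z else move x y

/-- The lazy version of a chain: with probability one half, nothing happens. -/
def lazy (P : Matrix Ω Ω ℝ) : Matrix Ω Ω ℝ := (1 / 2 : ℝ) • (1 + P)

/-- The relaxation time `1 / (1 - max {|μ| : μ an eigenvalue of P, μ ≠ 1})` of a reversible
irreducible chain, written as the largest `1 / (1 - |μ|)`. The value is `∞` if there is no
absolute spectral gap, and a chain with a single state has relaxation time `0`. -/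
def relaxationTime (P : Matrix Ω Ω ℝ) : ENNReal :=
  ⨆ μ ∈ {μ : ℝ | Module.End.HasEigenvalue (Matrix.toLin' P) μ ∧ μ ≠ 1},
    (ENNReal.ofReal (1 - |μ|))⁻¹

/-- The set of transitions of a chain (the edges of its transition graph). -/
def transitions (P : Matrix Ω Ω ℝ) : SetRel Ω Ω := {t | 0 < P t.1 t.2}

/-- A set of canonical paths: for every initial state `I` and every final state `F ∈ S`, a path
from `I` to `F` in the transition graph of `P` (visiting no state twice). -/
structure CanonicalPaths (P : Matrix Ω Ω ℝ) (S : Finset Ω) where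
  path : Ω → S → RelSeries (transitions P)
  head_eq : ∀ I F, (path I F).head = I
  last_eq : ∀ I F, (path I F).last = F
  injective : ∀ I F, Function.Injective (path I F).toFun

/-- The path `γ` goes through the transition `t`. -/
def Uses {P : Matrix Ω Ω ℝ} (γ : RelSeries (transitions P)) (t : Ω × Ω) : Prop :=
  ∃ i : Fin γ.length, γ.toFun i.castSucc = t.1 ∧ γ.toFun i.succ = t.2

namespace CanonicalPaths

variable {P : Matrix Ω Ω ℝ} {S : Finset Ω}

/-- The length (number of transitions) of a longest path. -/
def maxLength (Γ : CanonicalPaths P S) : ℕ :=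
  Finset.univ.sup fun p : Ω × S => (Γ.path p.1 p.2).length

open Classical in
/-- The congestion: the maximum over all transitions `t` of the flow through `t` divided by the
capacity of `t`. -/
def congestion (Γ : CanonicalPaths P S) (π : Ω → ℝ) : ℝ :=
  ⨆ t : transitions P, (π t.1.1 * P t.1.1 t.1.2)⁻¹ *
    ∑ I : Ω, ∑ F : S, if Uses (Γ.path I F) t.1 then π I * π F else 0

end CanonicalPaths

end MarkovChain

/-! ### The worm process -/

namespace Worm

variable {V : Type*} [Fintype V] [DecidableEq V]

/-- The set `∂A` of vertices of odd degree in the edge set `A`. -/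
def boundary (A : Finset (Sym2 V)) : Finset V :=
  Finset.univ.filter fun v => Odd (Finset.univ.filter fun u => s(u, v) ∈ A).card

/-- The measure `λ(A) = w ^ |A ⊕ M|` on edge sets. -/
def weight (w : ℝ) (M A : Finset (Sym2 V)) : ℝ := w ^ (A ∆ M).card

/-- The total measure `λ(𝒮)` of a family `𝒮` of edge sets. -/
def totalWeight (w : ℝ) (M : Finset (Sym2 V)) (𝒮 : Finset (Finset (Sym2 V))) : ℝ :=
  ∑ A ∈ 𝒮, weight w M A

variable (G : SimpleGraph V) [DecidableRel G.Adj]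

/-- The set `𝒞ₖ` of edge sets of `G` with exactly `k` vertices of odd degree. -/
def sector (k : ℕ) : Finset (Finset (Sym2 V)) :=
  G.edgeFinset.powerset.filter fun A => (boundary A).card = k

/-- `(χ₂, χ₄)`-bounded defect susceptibility. -/
def BoundedDefectSusceptibility (w : ℝ) (M : Finset (Sym2 V)) (χ₂ χ₄ : ℝ) : Prop :=
  totalWeight w M (sector G 2) / totalWeight w M (sector G 0) ≤ χ₂ ∧
    totalWeight w M (sector G 4) / totalWeight w M (sector G 0) ≤ χ₄

/-- The state space `𝒲 = 𝒞₀ ∪ 𝒞₂` of even and near-even subgraphs. -/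
abbrev State : Type _ := {A : Finset (Sym2 V) // A ∈ sector G 0 ∪ sector G 2}

/-- The even subgraphs, as a set of states. -/
def evenStates : Finset (State G) := Finset.univ.filter fun A => A.1 ∈ sector G 0

/-- The Prokof'ev–Svistunov measure. -/
def psMeasure (w : ℝ) (M : Finset (Sym2 V)) (A : State G) : ℝ :=
  (if A.1 ∈ sector G 0 then (Fintype.card V : ℝ) else 2) * weight w M A.1 /
    (Fintype.card V * totalWeight w M (sector G 0) + 2 * totalWeight w M (sector G 2))

/-- The vertices among which a proposal from `A` starts: all of them if `A ∈ 𝒞₀`, and the two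
odd vertices if `A ∈ 𝒞₂`. -/
def startVertices (A : State G) : Finset V :=
  if A.1 ∈ sector G 0 then Finset.univ else boundary A.1

/-- The proposal probabilities: choose a start vertex `v` uniformly, then a neighbour `u` of `v`
uniformly, and propose `A ⊕ uv`. If `v` is isolated, nothing is proposed. -/
def proposal : Matrix (State G) (State G) ℝ := Matrix.of fun A B =>
  ∑ v ∈ startVertices G A, ∑ u ∈ G.neighborFinset v,
    if B.1 = A.1 ∆ {s(u, v)} then 1 / ((startVertices G A).card : ℝ) * (1 / (G.degree v : ℝ))
    else 0

/-- The transition matrix of the lazy worm process. -/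
def lazyWorm (w : ℝ) (M : Finset (Sym2 V)) : Matrix (State G) (State G) ℝ :=
  MarkovChain.lazy (MarkovChain.metropolis (proposal G) (psMeasure G w M))

end Worm

end

/-!
The canonical path from `I` to an even `F` flips the edges of `I ∆ F` one at a time, in an order
(`unwinding`) that depends on `I ∆ F` only and leaves at most two odd vertices at each stage. Such
an order exists because an edge set with odd vertices has an edge at one of them, and removing that
edge does not create a new pair of odd vertices (`exists_list_card_boundary_drop_le`); no
decomposition into a path and cycles is needed. As `F` is even, the odd vertices of a state on the
path are those of the edges still to be flipped, so the path stays among the states, and each flip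
is a proposal of the worm process because otherwise it would produce four odd vertices.

For a transition `t` let `x` be the endpoint of smaller weight. The pairs `(I, F)` whose path uses
`t` are encoded by `η = I ∆ F ∆ x`. The encoding is injective (`eq_of_pathState_eq`): `η` gives
`I ∆ F`, hence the order of the flips, and the edge flipped by `t` tells which of them come before.
Since `x` arises from `I` by flipping edges of `I ∆ F`, `λ(I) λ(F) = λ(x) λ(η)`
(`weight_mul_weight`), and `λ(x)` is at most a constant times the capacity of `t`
(`min_weight_le`). The set `η` has at most two odd vertices if `I` is even and at most four
otherwise, so the sum of `Ψ(I) λ(η)` is bounded by `λ(𝒞₀)`, `λ(𝒞₂)` and `λ(𝒞₄)`. This gives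
`congestion_canonicalPaths_le`, a bound on `φ(Γ) / π(𝒞₀)` without the factor `w⁻¹`, and
`π(𝒞₀) ≤ 1` turns it into one on `φ(Γ)`.

For the relaxation time, an eigenvector `f` for an eigenvalue `μ ≠ 1` is centred, so its second
moment is at most the mean of `(f(I) - f(F))²` over `I` distributed by `π` and `F` by `π`
conditioned on `𝒞₀`. Cauchy–Schwarz along the paths compares this with the Dirichlet form
(`sum_sq_sub_le`), which is `1 - μ` times the second moment. Laziness makes `μ` nonnegative, and
`relaxationTime_lazy_le` follows with the factor `2` in place of `4`.
-/

set_option linter.unusedSectionVars false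

/-! ### Metropolis and lazy chains -/

namespace MarkovChain

open scoped Matrix

variable {Ω : Type*} [Fintype Ω] [DecidableEq Ω]

/-- The Metropolis chain equalizes the flow between two states to the smaller one of the two
proposed flows. -/
theorem mul_metropolis {K : Matrix Ω Ω ℝ} {π : Ω → ℝ} (hK : ∀ x y, 0 ≤ K x y)
    (hπ : ∀ x, 0 < π x) {x y : Ω} (hxy : x ≠ y) :
    π x * metropolis K π x y = min (π x * K x y) (π y * K y x) := by
  simp only [metropolis, Matrix.of_apply, if_neg hxy]
  rcases (hK x y).eq_or_lt with h | h
  · simp [← h, mul_nonneg (hπ y).le (hK y x)]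
  · have hp : 0 < π x * K x y := mul_pos (hπ x) h
    rw [← mul_assoc, mul_min_of_nonneg _ _ hp.le, mul_one, mul_div_cancel₀ _ hp.ne']

theorem mul_metropolis_comm {K : Matrix Ω Ω ℝ} {π : Ω → ℝ} (hK : ∀ x y, 0 ≤ K x y)
    (hπ : ∀ x, 0 < π x) (x y : Ω) :
    π x * metropolis K π x y = π y * metropolis K π y x := by
  rcases eq_or_ne x y with rfl | h
  · rfl
  · rw [mul_metropolis hK hπ h, mul_metropolis hK hπ h.symm, min_comm]

theorem sum_metropolis (K : Matrix Ω Ω ℝ) (π : Ω → ℝ) (x : Ω) :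
    ∑ y, metropolis K π x y = 1 := by
  rw [← Finset.add_sum_erase _ _ (Finset.mem_univ x)]
  simp only [metropolis, Matrix.of_apply, if_true]
  rw [sub_add_eq_add_sub, sub_eq_iff_eq_add, add_right_inj]
  exact Finset.sum_congr rfl fun y hy => if_neg (Finset.ne_of_mem_erase hy).symm

theorem metropolis_nonneg {K : Matrix Ω Ω ℝ} {π : Ω → ℝ} (hK : ∀ x y, 0 ≤ K x y)
    (hK1 : ∀ x, ∑ y, K x y ≤ 1) (hπ : ∀ x, 0 < π x) (x y : Ω) :
    0 ≤ metropolis K π x y := by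
  have hm : ∀ z, 0 ≤ min 1 (π z * K z x / (π x * K x z)) := fun z =>
    le_min zero_le_one
      (div_nonneg (mul_nonneg (hπ z).le (hK z x)) (mul_nonneg (hπ x).le (hK x z)))
  simp only [metropolis, Matrix.of_apply]
  split_ifs with h
  · refine sub_nonneg.2 (le_trans ?_ (hK1 x))
    calc ∑ z ∈ Finset.univ.erase x, K x z * min 1 (π z * K z x / (π x * K x z))
        ≤ ∑ z ∈ Finset.univ.erase x, K x z :=
          Finset.sum_le_sum fun z _ => mul_le_of_le_one_right (hK x z) (min_le_left _ _)
      _ ≤ ∑ z, K x z :=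
          Finset.sum_le_sum_of_subset_of_nonneg (Finset.erase_subset _ _) fun z _ _ => hK x z
  · exact mul_nonneg (hK x y) (hm y)

theorem lazy_apply_of_ne (P : Matrix Ω Ω ℝ) {x y : Ω} (h : x ≠ y) :
    lazy P x y = 1 / 2 * P x y := by
  simp [lazy, Matrix.one_apply_ne h]

theorem lazy_nonneg {P : Matrix Ω Ω ℝ} (hP : ∀ x y, 0 ≤ P x y) (x y : Ω) :
    0 ≤ lazy P x y := by
  have h1 : (0 : ℝ) ≤ (1 : Matrix Ω Ω ℝ) x y := by
    rw [Matrix.one_apply]; split_ifs <;> norm_num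
  have := hP x y
  simp only [lazy, Matrix.smul_apply, Matrix.add_apply, smul_eq_mul]
  positivity

/-! ### Dirichlet forms, eigenvalues and canonical paths -/

/-- An eigenvalue of the lazy chain is `(1 + μ) / 2` for an eigenvalue `μ` of the chain. -/
theorem mulVec_of_lazy_mulVec {Q : Matrix Ω Ω ℝ} {f : Ω → ℝ} {μ : ℝ}
    (h : lazy Q *ᵥ f = μ • f) : Q *ᵥ f = (2 * μ - 1) • f := by
  ext x
  have hx := congrFun h x
  simp only [lazy, Matrix.smul_mulVec, Matrix.add_mulVec, Matrix.one_mulVec, Pi.smul_apply,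
    Pi.add_apply, smul_eq_mul] at hx ⊢
  linarith

/-- The quadratic forms `∑ π(x) Q(x,y) (f(x) ± f(y))²`, at an eigenvector `f` of a reversible
chain `Q`. -/
theorem sum_mul_add_mul_sq {Q : Matrix Ω Ω ℝ} {π f : Ω → ℝ} {μ : ℝ}
    (hrow : ∀ x, ∑ y, Q x y = 1) (hrev : ∀ x y, π x * Q x y = π y * Q y x)
    (hf : Q *ᵥ f = μ • f) {ε : ℝ} (hε : ε ^ 2 = 1) :
    ∑ x, ∑ y, π x * Q x y * (f x + ε * f y) ^ 2 = 2 * (1 + ε * μ) * ∑ x, π x * f x ^ 2 := by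
  have h1 : ∑ x, ∑ y, π x * Q x y * f x ^ 2 = ∑ x, π x * f x ^ 2 :=
    Finset.sum_congr rfl fun x _ => by
      rw [← Finset.sum_mul, ← Finset.mul_sum, hrow, mul_one]
  have h2 : ∑ x, ∑ y, π x * Q x y * f y ^ 2 = ∑ x, π x * f x ^ 2 := by
    rw [← h1, Finset.sum_comm]
    exact Finset.sum_congr rfl fun x _ => Finset.sum_congr rfl fun y _ => by rw [hrev]
  have h3 : ∑ x, ∑ y, π x * Q x y * (f x * f y) = μ * ∑ x, π x * f x ^ 2 := by
    rw [Finset.mul_sum]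
    refine Finset.sum_congr rfl fun x _ => ?_
    have hx : ∑ y, Q x y * f y = μ * f x := congrFun hf x
    calc ∑ y, π x * Q x y * (f x * f y) = π x * f x * ∑ y, Q x y * f y := by
          rw [Finset.mul_sum]; exact Finset.sum_congr rfl fun y _ => by ring
      _ = _ := by rw [hx]; ring
  calc ∑ x, ∑ y, π x * Q x y * (f x + ε * f y) ^ 2
      = ∑ x, ∑ y, (π x * Q x y * f x ^ 2 + 2 * ε * (π x * Q x y * (f x * f y)) +
          π x * Q x y * f y ^ 2) := by
        refine Finset.sum_congr rfl fun x _ => Finset.sum_congr rfl fun y _ => ?_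
        linear_combination π x * Q x y * f y ^ 2 * hε
    _ = _ := by
        simp only [Finset.sum_add_distrib, ← Finset.mul_sum]
        rw [h1, h2, h3]; ring

/-- An eigenvector for an eigenvalue other than `1` is orthogonal to the constants. -/
theorem sum_mul_eq_zero {Q : Matrix Ω Ω ℝ} {π f : Ω → ℝ} {μ : ℝ}
    (hrow : ∀ x, ∑ y, Q x y = 1) (hrev : ∀ x y, π x * Q x y = π y * Q y x)
    (hf : Q *ᵥ f = μ • f) (hμ : μ ≠ 1) : ∑ x, π x * f x = 0 := by
  have h1 : ∑ x, ∑ y, π x * Q x y * f y = ∑ x, π x * f x := by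
    rw [Finset.sum_comm]
    refine Finset.sum_congr rfl fun y _ => ?_
    simp_rw [fun x => hrev x y]
    rw [← Finset.sum_mul, ← Finset.mul_sum, hrow, mul_one]
  have h2 : ∑ x, ∑ y, π x * Q x y * f y = μ * ∑ x, π x * f x := by
    rw [Finset.mul_sum]
    refine Finset.sum_congr rfl fun x _ => ?_
    have hx : ∑ y, Q x y * f y = μ * f x := congrFun hf x
    simp_rw [mul_assoc]
    rw [← Finset.mul_sum, hx]; ring
  have h3 : (μ - 1) * ∑ x, π x * f x = 0 := by linarith
  exact (mul_eq_zero.1 h3).resolve_left (sub_ne_zero.2 hμ)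

open Classical in
/-- Cauchy–Schwarz along a path without repeated states. -/
theorem sq_sub_le_length_mul_sum {P : Matrix Ω Ω ℝ} (γ : RelSeries (transitions P))
    (hγ : Function.Injective γ.toFun) (f : Ω → ℝ) :
    (f γ.head - f γ.last) ^ 2 ≤
      γ.length * ∑ t : Ω × Ω, if Uses γ t then (f t.1 - f t.2) ^ 2 else 0 := by
  have htel : f γ.last - f γ.head =
      ∑ i : Fin γ.length, (f (γ.toFun i.succ) - f (γ.toFun i.castSucc)) := by
    have key : ∀ (n : ℕ) (g : Fin (n + 1) → ℝ),
        ∑ i : Fin n, (g i.succ - g i.castSucc) = g (Fin.last n) - g 0 := by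
      intro n g
      rw [Finset.sum_sub_distrib]
      have h1 := Fin.sum_univ_succ g
      have h2 := Fin.sum_univ_castSucc g
      linarith
    exact (key γ.length fun i => f (γ.toFun i)).symm
  have hcs : (f γ.head - f γ.last) ^ 2 ≤
      γ.length * ∑ i : Fin γ.length, (f (γ.toFun i.castSucc) - f (γ.toFun i.succ)) ^ 2 := by
    have := sq_sum_le_card_mul_sum_sq (s := (Finset.univ : Finset (Fin γ.length)))
      (f := fun i => f (γ.toFun i.succ) - f (γ.toFun i.castSucc))
    rw [← htel, Finset.card_univ, Fintype.card_fin] at this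
    calc (f γ.head - f γ.last) ^ 2 = (f γ.last - f γ.head) ^ 2 := by ring
      _ ≤ _ := this
      _ = _ := by
        congr 1; exact Finset.sum_congr rfl fun i _ => by ring
  refine hcs.trans (mul_le_mul_of_nonneg_left ?_ (Nat.cast_nonneg _))
  rw [← Finset.sum_filter]
  let e : Fin γ.length → Ω × Ω := fun i => (γ.toFun i.castSucc, γ.toFun i.succ)
  have he : Function.Injective e := fun i j hij =>
    Fin.castSucc_injective _ (hγ (Prod.ext_iff.1 hij).1)
  calc ∑ i : Fin γ.length, (f (γ.toFun i.castSucc) - f (γ.toFun i.succ)) ^ 2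
      = ∑ t ∈ Finset.univ.image e, (f t.1 - f t.2) ^ 2 := by
        rw [Finset.sum_image fun i _ j _ h => he h]
    _ ≤ _ := by
        refine Finset.sum_le_sum_of_subset_of_nonneg ?_ fun t _ _ => sq_nonneg _
        intro t ht
        obtain ⟨i, -, rfl⟩ := Finset.mem_image.1 ht
        exact Finset.mem_filter.2 ⟨Finset.mem_univ _, i, rfl, rfl⟩

theorem Uses.mem_transitions {P : Matrix Ω Ω ℝ} {γ : RelSeries (transitions P)} {t : Ω × Ω}
    (h : Uses γ t) : t ∈ transitions P := by
  obtain ⟨i, h1, h2⟩ := h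
  have := γ.step i
  rwa [h1, h2] at this

namespace CanonicalPaths

variable {P : Matrix Ω Ω ℝ} {S : Finset Ω}

open Classical in
theorem flow_le (Γ : CanonicalPaths P S) {π : Ω → ℝ} (hπ : ∀ x, 0 < π x) {t : Ω × Ω}
    (ht : t ∈ transitions P) :
    (∑ I : Ω, ∑ F : S, if Uses (Γ.path I F) t then π I * π F else 0) ≤
      Γ.congestion π * (π t.1 * P t.1 t.2) := by
  have hc : 0 < π t.1 * P t.1 t.2 := mul_pos (hπ _) ht
  have h := le_ciSup (f := fun t : transitions P => (π t.1.1 * P t.1.1 t.1.2)⁻¹ *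
    ∑ I : Ω, ∑ F : S, if Uses (Γ.path I F) t.1 then π I * π F else 0)
    (Set.finite_range _).bddAbove ⟨t, ht⟩
  rwa [inv_mul_eq_div, div_le_iff₀ hc] at h

/-- Comparison of the variation of `f` between the two ends of the canonical paths with the
Dirichlet form of the chain. -/
theorem sum_sq_sub_le (Γ : CanonicalPaths P S) {π : Ω → ℝ} (hπ : ∀ x, 0 < π x)
    (hP : ∀ x y, 0 ≤ P x y) (hφ : 0 ≤ Γ.congestion π) (f : Ω → ℝ) :
    ∑ I : Ω, ∑ F : S, π I * π F * (f I - f F) ^ 2 ≤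
      Γ.maxLength * Γ.congestion π * ∑ x, ∑ y, π x * P x y * (f x - f y) ^ 2 := by
  classical
  have h1 : ∀ I : Ω, ∀ F : S, π I * π F * (f I - f F) ^ 2 ≤ Γ.maxLength *
      ∑ t : Ω × Ω, (f t.1 - f t.2) ^ 2 * if Uses (Γ.path I F) t then π I * π F else 0 := by
    intro I F
    have h := sq_sub_le_length_mul_sum (Γ.path I F) (Γ.injective I F) f
    rw [Γ.head_eq, Γ.last_eq] at h
    have hlen : ((Γ.path I F).length : ℝ) ≤ Γ.maxLength := by
      exact_mod_cast Finset.le_sup (f := fun p : Ω × S => (Γ.path p.1 p.2).length)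
        (Finset.mem_univ (I, F))
    have h' := h.trans (mul_le_mul_of_nonneg_right hlen
      (Finset.sum_nonneg fun t _ => by split_ifs <;> positivity))
    refine (mul_le_mul_of_nonneg_left h' (mul_pos (hπ I) (hπ F)).le).trans_eq ?_
    rw [mul_left_comm, Finset.mul_sum]
    congr 1
    exact Finset.sum_congr rfl fun t _ => by split_ifs <;> ring
  calc ∑ I : Ω, ∑ F : S, π I * π F * (f I - f F) ^ 2
      ≤ ∑ I : Ω, ∑ F : S, Γ.maxLength *
          ∑ t : Ω × Ω, (f t.1 - f t.2) ^ 2 * if Uses (Γ.path I F) t then π I * π F else 0 :=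
        Finset.sum_le_sum fun I _ => Finset.sum_le_sum fun F _ => h1 I F
    _ = Γ.maxLength * ∑ t : Ω × Ω, (f t.1 - f t.2) ^ 2 *
          ∑ I : Ω, ∑ F : S, if Uses (Γ.path I F) t then π I * π F else 0 := by
        simp_rw [← Finset.mul_sum]
        congr 1
        rw [Finset.sum_congr rfl fun I _ => Finset.sum_comm, Finset.sum_comm]
        simp_rw [Finset.mul_sum]
    _ ≤ Γ.maxLength * ∑ t : Ω × Ω, (f t.1 - f t.2) ^ 2 *
          (Γ.congestion π * (π t.1 * P t.1 t.2)) := by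
        refine mul_le_mul_of_nonneg_left (Finset.sum_le_sum fun t _ =>
          mul_le_mul_of_nonneg_left ?_ (sq_nonneg _)) (Nat.cast_nonneg _)
        by_cases ht : t ∈ transitions P
        · exact Γ.flow_le hπ ht
        · have h0 : ∀ I F, ¬ Uses (Γ.path I F) t := fun I F h => ht h.mem_transitions
          simp only [h0, if_false, Finset.sum_const_zero]
          exact mul_nonneg hφ (mul_nonneg (hπ _).le (hP _ _))
    _ = _ := by
        rw [← Fintype.sum_prod_type', mul_assoc, Finset.mul_sum (a := Γ.congestion π)]
        congr 1
        exact Finset.sum_congr rfl fun t _ => by ring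

end CanonicalPaths

/-- The variance of a centred `f` is at most its mean squared distance to a random point of
`S`. -/
theorem sum_mul_sum_sq_le {π : Ω → ℝ} (hπ : ∀ x, 0 < π x) (hπ1 : ∑ x, π x = 1)
    (S : Finset Ω) {f : Ω → ℝ} (hf : ∑ x, π x * f x = 0) :
    (∑ F ∈ S, π F) * ∑ x, π x * f x ^ 2 ≤ ∑ I : Ω, ∑ F : S, π I * π F * (f I - f F) ^ 2 := by
  rw [Finset.sum_comm, Finset.sum_mul, ← Finset.sum_coe_sort S]
  refine Finset.sum_le_sum fun F _ => ?_
  have h : ∑ I, π I * π F * (f I - f F) ^ 2 =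
      π F * (∑ x, π x * f x ^ 2 - 2 * f F * ∑ x, π x * f x + f F ^ 2 * ∑ x, π x) := by
    simp only [Finset.mul_sum, ← Finset.sum_sub_distrib, ← Finset.sum_add_distrib]
    exact Finset.sum_congr rfl fun x _ => by ring
  rw [h, hf, hπ1]
  exact mul_le_mul_of_nonneg_left (by nlinarith [sq_nonneg (f F)]) (hπ F).le

/-- Canonical paths into a set `S` bound the relaxation time of a lazy reversible chain: the
spectral gap is at least `π(S) / (2 L φ)`, where `φ` is the congestion and `L` the length of the
longest path. -/
theorem relaxationTime_lazy_le {Q : Matrix Ω Ω ℝ} {π : Ω → ℝ} {S : Finset Ω}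
    (hπ : ∀ x, 0 < π x) (hπ1 : ∑ x, π x = 1) (hS : S.Nonempty)
    (hQ : ∀ x y, 0 ≤ Q x y) (hrow : ∀ x, ∑ y, Q x y = 1)
    (hrev : ∀ x y, π x * Q x y = π y * Q y x)
    (Γ : CanonicalPaths (lazy Q) S) (hφ : 0 ≤ Γ.congestion π) :
    relaxationTime (lazy Q) ≤
      ENNReal.ofReal (2 * Γ.maxLength * (Γ.congestion π / ∑ F ∈ S, π F)) := by
  have hP := lazy_nonneg hQ
  have hrowP : ∀ x, ∑ y, lazy Q x y = 1 := fun x => by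
    simp only [lazy, Matrix.smul_apply, Matrix.add_apply, smul_eq_mul, ← Finset.mul_sum,
      Finset.sum_add_distrib, hrow, Matrix.one_apply]
    simp; norm_num
  have hrevP : ∀ x y, π x * lazy Q x y = π y * lazy Q y x := fun x y => by
    rcases eq_or_ne x y with rfl | h
    · rfl
    · rw [lazy_apply_of_ne _ h, lazy_apply_of_ne _ h.symm]; linarith [hrev x y]
  refine iSup₂_le fun μ hμ => ?_
  obtain ⟨f, hf⟩ := hμ.1.exists_hasEigenvector
  have hfe : lazy Q *ᵥ f = μ • f := by simpa using hf.apply_eq_smul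
  set N : ℝ := ∑ x, π x * f x ^ 2 with hN
  have hNpos : 0 < N := by
    obtain ⟨x, hx⟩ := Function.ne_iff.1 hf.2
    exact Finset.sum_pos' (fun y _ => mul_nonneg (hπ y).le (sq_nonneg _))
      ⟨x, Finset.mem_univ x, mul_pos (hπ x) (sq_pos_of_ne_zero hx)⟩
  -- `2 * μ - 1` is an eigenvalue of `Q`, so it is at least `-1`.
  have hμ0 : 0 ≤ μ := by
    have h := sum_mul_add_mul_sq hrow hrev (mulVec_of_lazy_mulVec hfe) (ε := 1) (by norm_num)
    have h0 : 0 ≤ 2 * (1 + 1 * (2 * μ - 1)) * N := h ▸ Finset.sum_nonneg fun x _ =>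
      Finset.sum_nonneg fun y _ => mul_nonneg (mul_nonneg (hπ x).le (hQ x y)) (sq_nonneg _)
    have := nonneg_of_mul_nonneg_left h0 hNpos
    linarith
  have hE := sum_mul_add_mul_sq hrowP hrevP hfe (ε := -1) (by norm_num)
  simp only [neg_one_mul, ← sub_eq_add_neg] at hE
  have hμ1 : 0 ≤ 1 - μ := by
    have h0 : 0 ≤ 2 * (1 - μ) * N := hE ▸ Finset.sum_nonneg fun x _ =>
      Finset.sum_nonneg fun y _ => mul_nonneg (mul_nonneg (hπ x).le (hP x y)) (sq_nonneg _)
    have := nonneg_of_mul_nonneg_left h0 hNpos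
    linarith
  have hSpos : 0 < ∑ F ∈ S, π F := Finset.sum_pos (fun x _ => hπ x) hS
  have h := (sum_mul_sum_sq_le hπ hπ1 S (sum_mul_eq_zero hrowP hrevP hfe hμ.2)).trans
    (Γ.sum_sq_sub_le hπ hP hφ f)
  rw [hE] at h
  set C : ℝ := 2 * Γ.maxLength * (Γ.congestion π / ∑ F ∈ S, π F) with hC
  have h1 : 1 ≤ C * (1 - μ) := by
    have h2 : (∑ F ∈ S, π F) * N * 1 ≤ (∑ F ∈ S, π F) * N * (C * (1 - μ)) := by
      refine le_of_eq_of_le (mul_one _) (h.trans_eq ?_)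
      rw [hC, hN]; field_simp
    exact le_of_mul_le_mul_left h2 (mul_pos hSpos hNpos)
  have hgap : 0 < 1 - μ := by
    refine lt_of_le_of_ne hμ1 fun h0 => ?_
    rw [← h0] at h1; norm_num at h1
  rw [abs_of_nonneg hμ0, ← ENNReal.ofReal_inv_of_pos hgap]
  exact ENNReal.ofReal_le_ofReal ((inv_le_iff_one_le_mul₀ hgap).2 h1)

end MarkovChain

/-! ### Odd vertices of edge sets -/

theorem Finset.card_symmDiff_add_two_mul_card_inter {α : Type*} [DecidableEq α]
    (s t : Finset α) : (s ∆ t).card + 2 * (s ∩ t).card = s.card + t.card := by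
  have h1 := Finset.card_sdiff_add_card_inter s t
  have h2 := Finset.card_sdiff_add_card_inter t s
  rw [Finset.inter_comm t s] at h2
  have h3 : (s ∆ t).card = (s \ t).card + (t \ s).card :=
    Finset.card_union_of_disjoint disjoint_sdiff_sdiff
  omega

theorem Finset.odd_card_symmDiff {α : Type*} [DecidableEq α] (s t : Finset α) :
    Odd (s ∆ t).card ↔ ¬(Odd s.card ↔ Odd t.card) := by
  have h := Finset.card_symmDiff_add_two_mul_card_inter s t
  rw [Nat.odd_iff, Nat.odd_iff, Nat.odd_iff]
  omega

theorem Finset.card_symmDiff_le {α : Type*} [DecidableEq α] (s t : Finset α) :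
    (s ∆ t).card ≤ s.card + t.card := by
  have h := Finset.card_symmDiff_add_two_mul_card_inter s t
  omega

/-- Swapping part of the difference of two sets does not change the sum of their sizes. -/
theorem Finset.card_symmDiff_add_card_symmDiff {α : Type*} [DecidableEq α] {s t u : Finset α}
    (hu : u ⊆ s ∆ t) : (s ∆ u).card + (t ∆ u).card = s.card + t.card := by
  have h1 := Finset.card_symmDiff_add_two_mul_card_inter s t
  have h2 := Finset.card_symmDiff_add_two_mul_card_inter (s ∆ u) (t ∆ u)
  have h3 : (s ∆ u) ∆ (t ∆ u) = s ∆ t := by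
    rw [symmDiff_symmDiff_symmDiff_comm, symmDiff_self, symmDiff_bot]
  have h4 : (s ∆ u) ∩ (t ∆ u) = s ∩ t := by
    ext x
    have := @hu x
    simp only [Finset.mem_symmDiff, Finset.mem_inter] at this ⊢
    tauto
  rw [h3, h4] at h2
  omega

namespace Worm

variable {V : Type*} [Fintype V] [DecidableEq V]

theorem boundary_symmDiff (A B : Finset (Sym2 V)) :
    boundary (A ∆ B) = boundary A ∆ boundary B := by
  ext v
  have h : (Finset.univ.filter fun u => s(u, v) ∈ A ∆ B) =
      (Finset.univ.filter fun u => s(u, v) ∈ A) ∆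
        (Finset.univ.filter fun u => s(u, v) ∈ B) := by
    ext u; simp [Finset.mem_symmDiff]
  rw [Finset.mem_symmDiff]
  simp only [boundary, Finset.mem_filter_univ]
  rw [h, Finset.odd_card_symmDiff]
  tauto

@[simp]
theorem boundary_empty : boundary (∅ : Finset (Sym2 V)) = ∅ := by
  simp [boundary]

theorem boundary_singleton {a b : V} (hab : a ≠ b) : boundary {s(a, b)} = {a, b} := by
  ext v
  simp only [boundary, Finset.mem_filter_univ, Finset.mem_singleton, Finset.mem_insert]
  by_cases hva : v = a
  · subst hva
    have : (Finset.univ.filter fun u => s(u, v) = s(v, b)) = {b} := by ext u; simp; grind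
    rw [this]; simp
  · by_cases hvb : v = b
    · subst hvb
      have : (Finset.univ.filter fun u => s(u, v) = s(a, v)) = {a} := by ext u; simp; grind
      rw [this]; simp
    · have : (Finset.univ.filter fun u => s(u, v) = s(a, b)) = ∅ := by ext u; simp; grind
      rw [this]; simp [hva, hvb]

variable (G : SimpleGraph V) [DecidableRel G.Adj]

/-- The handshake lemma. -/
theorem even_card_boundary {A : Finset (Sym2 V)} (hA : A ⊆ G.edgeFinset) :
    Even (boundary A).card := by
  induction A using Finset.induction_on with
  | empty => simp
  | insert e A he ih =>
    have h1 : insert e A = {e} ∆ A := by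
      ext x; simp only [Finset.mem_insert, Finset.mem_symmDiff, Finset.mem_singleton]
      grind
    have h2 := ih fun x hx => hA (Finset.mem_insert_of_mem hx)
    have h3 : e ∈ G.edgeFinset := hA (Finset.mem_insert_self e A)
    induction e with | _ a b =>
    have hab : a ≠ b := G.ne_of_adj (by simpa using h3)
    rw [h1, boundary_symmDiff, boundary_singleton hab, ← Nat.not_odd_iff_even,
      Finset.odd_card_symmDiff, Finset.card_pair hab]
    simp [Nat.not_odd_iff_even.2 h2]

theorem mem_sector {k : ℕ} {A : Finset (Sym2 V)} :
    A ∈ sector G k ↔ A ⊆ G.edgeFinset ∧ (boundary A).card = k := by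
  simp [sector]

theorem mem_states {A : Finset (Sym2 V)} :
    A ∈ sector G 0 ∪ sector G 2 ↔ A ⊆ G.edgeFinset ∧ (boundary A).card ≤ 2 := by
  rw [Finset.mem_union, mem_sector, mem_sector]
  constructor
  · rintro (⟨h, h'⟩ | ⟨h, h'⟩) <;> exact ⟨h, by omega⟩
  · rintro ⟨h, h'⟩
    obtain ⟨k, hk⟩ := even_card_boundary G h
    have : k = 0 ∨ k = 1 := by omega
    rcases this with rfl | rfl
    · exact Or.inl ⟨h, hk⟩
    · exact Or.inr ⟨h, hk⟩

theorem boundary_eq_empty {A : Finset (Sym2 V)} (hA : A ∈ sector G 0) : boundary A = ∅ :=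
  Finset.card_eq_zero.1 ((mem_sector G).1 hA).2

theorem disjoint_sector {j k : ℕ} (h : j ≠ k) : Disjoint (sector G j) (sector G k) :=
  Finset.disjoint_left.2 fun _ hj hk =>
    h (((mem_sector G).1 hj).2.symm.trans ((mem_sector G).1 hk).2)

/-! ### Unwinding a difference edge by edge -/

/-- An edge set with at most two odd vertices can be emptied edge by edge without ever creating
more than two odd vertices: if there are odd vertices, remove an edge at one of them. -/
theorem exists_list_card_boundary_drop_le {D : Finset (Sym2 V)} (hD : D ⊆ G.edgeFinset)
    (h2 : (boundary D).card ≤ 2) :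
    ∃ l : List (Sym2 V), l.Nodup ∧ l.toFinset = D ∧
      ∀ i, (boundary (l.drop i).toFinset).card ≤ 2 := by
  induction hn : D.card generalizing D with
  | zero =>
    rw [Finset.card_eq_zero] at hn
    exact ⟨[], by simp [hn]⟩
  | succ n ih =>
    have hstep : ∃ e ∈ D, (boundary (D.erase e)).card ≤ 2 := by
      have herase : ∀ e ∈ D, D.erase e = D ∆ {e} := fun e he => by
        ext x; simp only [Finset.mem_erase, Finset.mem_symmDiff, Finset.mem_singleton]
        grind
      rcases (boundary D).eq_empty_or_nonempty with h0 | ⟨v, hv⟩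
      · obtain ⟨e, he⟩ : D.Nonempty := Finset.card_pos.1 (by omega)
        refine ⟨e, he, ?_⟩
        rw [herase e he, boundary_symmDiff, h0]
        induction e with | _ a b =>
        have hab : a ≠ b := G.ne_of_adj (by simpa using hD he)
        rw [boundary_singleton hab]
        exact (Finset.card_symmDiff_le _ _).trans (by simp [Finset.card_pair hab])
      · have hodd := (Finset.mem_filter.1 hv).2
        obtain ⟨u, hu⟩ : (Finset.univ.filter fun u => s(u, v) ∈ D).Nonempty :=
          Finset.card_pos.1 hodd.pos
        have he : s(u, v) ∈ D := (Finset.mem_filter.1 hu).2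
        have huv : u ≠ v := G.ne_of_adj (by simpa using hD he)
        refine ⟨_, he, ?_⟩
        rw [herase _ he, boundary_symmDiff, boundary_singleton huv]
        have hc := Finset.card_symmDiff_add_two_mul_card_inter (boundary D) {u, v}
        have hi : 0 < (boundary D ∩ {u, v}).card :=
          Finset.card_pos.2 ⟨v, Finset.mem_inter.2 ⟨hv, by simp⟩⟩
        rw [Finset.card_pair huv] at hc
        omega
    obtain ⟨e, he, hb⟩ := hstep
    obtain ⟨l, hl, hlD, hlb⟩ := ih ((Finset.erase_subset e D).trans hD) hb
      (by rw [Finset.card_erase_of_mem he]; omega)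
    have hel : e ∉ l := fun h => by
      have := List.mem_toFinset.2 h
      rw [hlD] at this
      exact Finset.notMem_erase e D this
    have hcons : (e :: l).toFinset = D := by
      rw [List.toFinset_cons, hlD, Finset.insert_erase he]
    refine ⟨e :: l, List.nodup_cons.2 ⟨hel, hl⟩, hcons, fun i => ?_⟩
    cases i with
    | zero => rw [List.drop_zero, hcons]; exact h2
    | succ i => exact hlb i

open Classical in
/-- A chosen order on the edges of `D` in which they can be removed one by one with at most two
odd vertices at any time (`[]` if there is none). It depends on `D` alone, which is what makes
canonical paths built from it decodable. -/
noncomputable def unwinding (D : Finset (Sym2 V)) : List (Sym2 V) :=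
  if h : ∃ l : List (Sym2 V), l.Nodup ∧ l.toFinset = D ∧
      ∀ i, (boundary (l.drop i).toFinset).card ≤ 2
  then h.choose else []

theorem unwinding_spec {D : Finset (Sym2 V)} (hD : D ⊆ G.edgeFinset)
    (h2 : (boundary D).card ≤ 2) :
    (unwinding D).Nodup ∧ (unwinding D).toFinset = D ∧
      ∀ i, (boundary ((unwinding D).drop i).toFinset).card ≤ 2 := by
  have h := exists_list_card_boundary_drop_le G hD h2
  rw [unwinding, dif_pos h]
  exact h.choose_spec

theorem toFinset_take_symmDiff_toFinset_drop {α : Type*} [DecidableEq α] {l : List α}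
    (hl : l.Nodup) (i : ℕ) : (l.take i).toFinset ∆ (l.drop i).toFinset = l.toFinset := by
  have hd : Disjoint (l.take i).toFinset (l.drop i).toFinset :=
    List.disjoint_toFinset_iff_disjoint.2 (List.disjoint_take_drop hl le_rfl)
  rw [hd.symmDiff_eq_sup, Finset.sup_eq_union, ← List.toFinset_append, List.take_append_drop]

theorem toFinset_take_symmDiff_toFinset_take_succ {α : Type*} [DecidableEq α] {l : List α}
    (hl : l.Nodup) {i : ℕ} (hi : i < l.length) :
    (l.take i).toFinset ∆ (l.take (i + 1)).toFinset = {l[i]} := by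
  have h : l[i] ∉ l.take i := by
    have := hl.sublist (List.take_sublist (i + 1) l)
    rw [← List.take_concat_get' l i hi, List.nodup_append] at this
    exact fun hm => this.2.2 _ hm _ (List.mem_singleton_self _) rfl
  rw [← List.take_concat_get' l i hi, List.toFinset_append]
  ext x
  simp only [Finset.mem_symmDiff, Finset.mem_union, List.mem_toFinset, Finset.mem_singleton,
    List.mem_singleton]
  grind

theorem mem_evenStates {F : State G} : F ∈ evenStates G ↔ F.1 ∈ sector G 0 := by
  simp [evenStates]

variable {G}

theorem State.subset (A : State G) : A.1 ⊆ G.edgeFinset := ((mem_states G).1 A.2).1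

theorem State.card_boundary_le (A : State G) : (boundary A.1).card ≤ 2 :=
  ((mem_states G).1 A.2).2

/-- The edges in which `I` and `F` differ, in the order in which the canonical path flips them. -/
noncomputable def flips (I : State G) (F : evenStates G) : List (Sym2 V) :=
  unwinding (I.1 ∆ F.1.1)

theorem symmDiff_subset {α : Type*} [DecidableEq α] {s t u : Finset α} (hs : s ⊆ u)
    (ht : t ⊆ u) : s ∆ t ⊆ u := fun x hx => by
  rcases Finset.mem_symmDiff.1 hx with h | h
  exacts [hs h.1, ht h.1]

theorem boundary_even (F : evenStates G) : boundary F.1.1 = ∅ :=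
  boundary_eq_empty G ((mem_evenStates G).1 F.2)

theorem flips_spec (I : State G) (F : evenStates G) :
    (flips I F).Nodup ∧ (flips I F).toFinset = I.1 ∆ F.1.1 ∧
      ∀ i, (boundary ((flips I F).drop i).toFinset).card ≤ 2 := by
  refine unwinding_spec G (symmDiff_subset I.subset F.1.subset) ?_
  rw [boundary_symmDiff, boundary_even, ← Finset.bot_eq_empty, symmDiff_bot]
  exact I.card_boundary_le

/-- The state on the canonical path from `I` to `F` after `i` flips. Its odd vertices are those
of the edges that are still to be flipped. -/
noncomputable def pathState (I : State G) (F : evenStates G) (i : ℕ) : State G :=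
  ⟨I.1 ∆ ((flips I F).take i).toFinset, by
    obtain ⟨h1, h2, h3⟩ := flips_spec I F
    have hsub : ((flips I F).take i).toFinset ⊆ I.1 ∆ F.1.1 := h2 ▸ fun x hx =>
      List.mem_toFinset.2 (List.mem_of_mem_take (List.mem_toFinset.1 hx))
    refine (mem_states G).2 ⟨symmDiff_subset I.subset
      (hsub.trans (symmDiff_subset I.subset F.1.subset)), ?_⟩
    have hF : I.1 ∆ ((flips I F).take i).toFinset =
        F.1.1 ∆ ((flips I F).drop i).toFinset := by
      have h4 := toFinset_take_symmDiff_toFinset_drop h1 i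
      rw [h2] at h4
      rw [← symmDiff_right_inj (a := I.1), symmDiff_symmDiff_cancel_left, ← symmDiff_assoc, ← h4,
        symmDiff_assoc, symmDiff_self, symmDiff_bot]
    rw [hF, boundary_symmDiff, boundary_even, ← Finset.bot_eq_empty, bot_symmDiff]
    exact h3 i⟩

theorem pathState_coe (I : State G) (F : evenStates G) (i : ℕ) :
    (pathState I F i).1 = I.1 ∆ ((flips I F).take i).toFinset := rfl

theorem pathState_zero (I : State G) (F : evenStates G) : pathState I F 0 = I := by
  apply Subtype.ext; simp [pathState_coe]

theorem pathState_length (I : State G) (F : evenStates G) :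
    pathState I F (flips I F).length = F := by
  apply Subtype.ext
  rw [pathState_coe, List.take_length, (flips_spec I F).2.1, symmDiff_symmDiff_cancel_left]

theorem pathState_symmDiff_succ (I : State G) (F : evenStates G) {i : ℕ}
    (hi : i < (flips I F).length) :
    (pathState I F i).1 ∆ (pathState I F (i + 1)).1 = {(flips I F)[i]} := by
  rw [pathState_coe, pathState_coe, symmDiff_symmDiff_symmDiff_comm, symmDiff_self,
    bot_symmDiff, toFinset_take_symmDiff_toFinset_take_succ (flips_spec I F).1 hi]

theorem pathState_injOn (I : State G) (F : evenStates G) :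
    Set.InjOn (pathState I F) (Set.Iic (flips I F).length) := by
  intro i hi j hj h
  have h' := congrArg Subtype.val h
  rw [pathState_coe, pathState_coe, symmDiff_right_inj] at h'
  have hc := congrArg Finset.card h'
  have hn := (flips_spec I F).1
  rw [List.toFinset_card_of_nodup (hn.sublist (List.take_sublist _ _)),
    List.toFinset_card_of_nodup (hn.sublist (List.take_sublist _ _)), List.length_take,
    List.length_take] at hc
  simp only [Set.mem_Iic] at hi hj
  omega

theorem flips_getElem_mem (I : State G) (F : evenStates G) {i : ℕ}
    (hi : i < (flips I F).length) : (flips I F)[i] ∈ G.edgeFinset := by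
  refine symmDiff_subset I.subset F.1.subset ?_
  rw [← (flips_spec I F).2.1]
  exact List.mem_toFinset.2 (List.getElem_mem hi)

theorem length_flips_le (I : State G) (F : evenStates G) :
    (flips I F).length ≤ G.edgeFinset.card := by
  rw [← List.toFinset_card_of_nodup (flips_spec I F).1, (flips_spec I F).2.1]
  exact Finset.card_le_card (symmDiff_subset I.subset F.1.subset)

/-! ### The Prokof'ev–Svistunov measure -/

theorem weight_pos {w : ℝ} (hw : 0 < w) (M A : Finset (Sym2 V)) : 0 < weight w M A :=
  pow_pos hw _

theorem totalWeight_nonneg {w : ℝ} (hw : 0 < w) (M : Finset (Sym2 V))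
    (𝒮 : Finset (Finset (Sym2 V))) : 0 ≤ totalWeight w M 𝒮 :=
  Finset.sum_nonneg fun A _ => (weight_pos hw M A).le

theorem totalWeight_union (w : ℝ) (M : Finset (Sym2 V)) {𝒮 𝒯 : Finset (Finset (Sym2 V))}
    (h : Disjoint 𝒮 𝒯) :
    totalWeight w M (𝒮 ∪ 𝒯) = totalWeight w M 𝒮 + totalWeight w M 𝒯 :=
  Finset.sum_union h

theorem sum_weight_le_totalWeight {ι : Type*} {w : ℝ} (hw : 0 < w) (M : Finset (Sym2 V))
    {U : Finset ι} {η : ι → Finset (Sym2 V)} (hη : Set.InjOn η U)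
    {𝒮 : Finset (Finset (Sym2 V))} (h𝒮 : ∀ p ∈ U, η p ∈ 𝒮) :
    ∑ p ∈ U, weight w M (η p) ≤ totalWeight w M 𝒮 := by
  classical
  rw [← Finset.sum_image (f := weight w M) hη]
  exact Finset.sum_le_sum_of_subset_of_nonneg (Finset.image_subset_iff.2 h𝒮)
    fun A _ _ => (weight_pos hw M A).le

/-- Exchanging edges between `A` and `B` preserves the product of their weights. -/
theorem weight_mul_weight (w : ℝ) (M : Finset (Sym2 V)) {A B S : Finset (Sym2 V)}
    (hS : S ⊆ A ∆ B) :
    weight w M A * weight w M B = weight w M (A ∆ S) * weight w M (A ∆ B ∆ (A ∆ S)) := by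
  have h1 : (A ∆ M) ∆ (B ∆ M) = A ∆ B := by
    rw [symmDiff_symmDiff_symmDiff_comm, symmDiff_self, symmDiff_bot]
  have h2 := Finset.card_symmDiff_add_card_symmDiff (s := A ∆ M) (t := B ∆ M) (h1 ▸ hS)
  have h3 : A ∆ B ∆ (A ∆ S) = B ∆ S := by
    rw [symmDiff_symmDiff_symmDiff_comm, symmDiff_self, bot_symmDiff]
  rw [h3, weight, weight, weight, weight, ← pow_add, ← pow_add, ← h2,
    symmDiff_right_comm A M S, symmDiff_right_comm B M S]

variable (G)

theorem totalWeight_sector_zero_pos {w : ℝ} (hw : 0 < w) (M : Finset (Sym2 V)) :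
    0 < totalWeight w M (sector G 0) :=
  Finset.sum_pos (fun A _ => weight_pos hw M A) ⟨∅, (mem_sector G).2 (by simp)⟩

/-- The normalizing constant `|V| λ(𝒞₀) + 2 λ(𝒞₂)` of the Prokof'ev–Svistunov measure. -/
noncomputable def normalizer (w : ℝ) (M : Finset (Sym2 V)) : ℝ :=
  Fintype.card V * totalWeight w M (sector G 0) + 2 * totalWeight w M (sector G 2)

theorem card_mul_le_normalizer {w : ℝ} (hw : 0 < w) (M : Finset (Sym2 V)) :
    Fintype.card V * totalWeight w M (sector G 0) ≤ normalizer G w M := by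
  have := totalWeight_nonneg hw M (sector G 2)
  rw [normalizer]; linarith

theorem normalizer_pos [Nonempty V] {w : ℝ} (hw : 0 < w) (M : Finset (Sym2 V)) :
    0 < normalizer G w M :=
  lt_of_lt_of_le (mul_pos (by exact_mod_cast Fintype.card_pos)
    (totalWeight_sector_zero_pos G hw M)) (card_mul_le_normalizer G hw M)

theorem card_startVertices (A : State G) :
    ((startVertices G A).card : ℝ) = if A.1 ∈ sector G 0 then (Fintype.card V : ℝ) else 2 := by
  rw [startVertices]
  split_ifs with h
  · rfl
  · have h2 := ((Finset.mem_union.1 A.2).resolve_left h)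
    rw [((mem_sector G).1 h2).2]; rfl

theorem card_startVertices_pos [Nonempty V] (A : State G) :
    (0 : ℝ) < (startVertices G A).card := by
  rw [card_startVertices]
  split_ifs
  · exact_mod_cast Fintype.card_pos
  · norm_num

theorem psMeasure_eq (w : ℝ) (M : Finset (Sym2 V)) (A : State G) :
    psMeasure G w M A = (startVertices G A).card * weight w M A.1 / normalizer G w M := by
  rw [card_startVertices]; rfl

theorem psMeasure_pos [Nonempty V] {w : ℝ} (hw : 0 < w) (M : Finset (Sym2 V)) (A : State G) :
    0 < psMeasure G w M A := by
  rw [psMeasure_eq]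
  exact div_pos (mul_pos (card_startVertices_pos G A) (weight_pos hw M _))
    (normalizer_pos G hw M)

theorem psMeasure_evenStates (w : ℝ) (M : Finset (Sym2 V)) (F : evenStates G) :
    psMeasure G w M F = Fintype.card V * weight w M F.1.1 / normalizer G w M := by
  rw [psMeasure, if_pos ((mem_evenStates G).1 F.2)]; rfl

theorem sum_evenStates (w : ℝ) (M : Finset (Sym2 V)) :
    ∑ F ∈ evenStates G, psMeasure G w M F =
      Fintype.card V * totalWeight w M (sector G 0) / normalizer G w M := by
  rw [← Finset.sum_coe_sort]
  simp_rw [psMeasure_evenStates]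
  rw [← Finset.sum_div, ← Finset.mul_sum, totalWeight]
  refine congrArg (fun s => (Fintype.card V : ℝ) * s / normalizer G w M) ?_
  rw [Finset.sum_coe_sort (evenStates G) fun A => weight w M A.1]
  refine Finset.sum_bij (fun A _ => A.1) (fun A hA => (mem_evenStates G).1 hA)
    (fun A _ B _ h => Subtype.ext h) (fun A hA => ?_) fun _ _ => rfl
  exact ⟨⟨A, Finset.mem_union_left _ hA⟩, (mem_evenStates G).2 hA, rfl⟩

theorem sum_psMeasure [Nonempty V] {w : ℝ} (hw : 0 < w) (M : Finset (Sym2 V)) :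
    ∑ A, psMeasure G w M A = 1 := by
  let f : Finset (Sym2 V) → ℝ := fun A =>
    (if A ∈ sector G 0 then (Fintype.card V : ℝ) else 2) * weight w M A
  have h0 : ∑ A ∈ sector G 0, f A = Fintype.card V * totalWeight w M (sector G 0) := by
    rw [totalWeight, Finset.mul_sum]
    exact Finset.sum_congr rfl fun A hA => by simp only [f, if_pos hA]
  have h2 : ∑ A ∈ sector G 2, f A = 2 * totalWeight w M (sector G 2) := by
    rw [totalWeight, Finset.mul_sum]
    refine Finset.sum_congr rfl fun A hA => ?_
    have hA0 : A ∉ sector G 0 :=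
      Finset.disjoint_right.1 (disjoint_sector G (show 0 ≠ 2 by norm_num)) hA
    simp only [f, if_neg hA0]
  calc ∑ A, psMeasure G w M A = ∑ A : State G, f A.1 / normalizer G w M := rfl
    _ = (∑ A ∈ sector G 0 ∪ sector G 2, f A) / normalizer G w M := by
      rw [← Finset.sum_div, Finset.sum_subtype _ (fun _ => Iff.rfl) f]
    _ = 1 := by
      rw [Finset.sum_union (disjoint_sector G (by norm_num)), h0, h2]
      exact div_self (normalizer_pos G hw M).ne'

/-! ### Transition probabilities of the worm process -/

theorem proposal_nonneg (A B : State G) : 0 ≤ proposal G A B :=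
  Finset.sum_nonneg fun _ _ => Finset.sum_nonneg fun _ _ => by split_ifs <;> positivity

theorem sum_proposal_le_one (A : State G) : ∑ B, proposal G A B ≤ 1 := by
  have hB : ∀ (C : Finset (Sym2 V)) (c : ℝ), 0 ≤ c →
      ∑ B : State G, (if B.1 = C then c else 0) ≤ c := by
    intro C c hc
    rw [Finset.sum_coe_sort (sector G 0 ∪ sector G 2) fun B => if B = C then c else 0,
      Finset.sum_ite_eq']
    split_ifs <;> simp [hc]
  simp only [proposal, Matrix.of_apply]
  rw [Finset.sum_comm]
  calc ∑ v ∈ startVertices G A, ∑ B : State G, ∑ u ∈ G.neighborFinset v,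
        (if B.1 = A.1 ∆ {s(u, v)} then
          1 / ((startVertices G A).card : ℝ) * (1 / (G.degree v : ℝ)) else 0)
      ≤ ∑ v ∈ startVertices G A, 1 / ((startVertices G A).card : ℝ) := by
        refine Finset.sum_le_sum fun v _ => ?_
        rw [Finset.sum_comm]
        refine (Finset.sum_le_sum fun u _ => hB _ _ (by positivity)).trans ?_
        rw [Finset.sum_const, G.card_neighborFinset_eq_degree, nsmul_eq_mul, mul_left_comm]
        exact mul_le_of_le_one_right (by positivity) (by
          rw [mul_one_div]; exact div_self_le_one _)
    _ ≤ 1 := by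
        rw [Finset.sum_const, nsmul_eq_mul, mul_one_div]; exact div_self_le_one _

/-- Two states that differ in one edge are joined by a proposal: that edge meets the start
vertices, as flipping an edge away from two odd vertices would make four of them. -/
theorem exists_mem_startVertices {A B : State G} {e : Sym2 V} (he : e ∈ G.edgeFinset)
    (h : A.1 ∆ B.1 = {e}) :
    ∃ v ∈ startVertices G A, ∃ u ∈ G.neighborFinset v, e = s(u, v) := by
  induction e with | _ a b =>
  have hadj : G.Adj a b := by simpa using he
  suffices h : a ∈ startVertices G A ∨ b ∈ startVertices G A by
    rcases h with h | h
    · exact ⟨a, h, b, by simpa using hadj, Sym2.eq_swap⟩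
    · exact ⟨b, h, a, by simpa using hadj.symm, rfl⟩
  rw [startVertices]
  split_ifs with h0
  · simp
  · by_contra! hab
    have h2 := ((mem_sector G).1 ((Finset.mem_union.1 A.2).resolve_left h0)).2
    have hB : boundary B.1 = boundary A.1 ∆ {a, b} := by
      rw [← boundary_singleton hadj.ne, ← boundary_symmDiff, ← h, symmDiff_symmDiff_cancel_left]
    have hc := Finset.card_symmDiff_add_two_mul_card_inter (boundary A.1) {a, b}
    have hi : boundary A.1 ∩ {a, b} = ∅ := by
      ext x
      simp only [Finset.mem_inter, Finset.mem_insert, Finset.mem_singleton, Finset.notMem_empty,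
        iff_false, not_and, not_or]
      exact fun hx => ⟨fun h => hab.1 (h ▸ hx), fun h => hab.2 (h ▸ hx)⟩
    rw [hi, ← hB, h2, Finset.card_pair hadj.ne, Finset.card_empty] at hc
    have := B.card_boundary_le
    omega

/-- A proposal that flips a given edge has probability at least `1 / (Ψ(A) Δ)`. -/
theorem one_le_maxDegree_mul_proposal [Nonempty V] {A B : State G} {e : Sym2 V}
    (he : e ∈ G.edgeFinset) (h : A.1 ∆ B.1 = {e}) :
    1 ≤ G.maxDegree * ((startVertices G A).card * proposal G A B) := by
  obtain ⟨v, hv, u, hu, rfl⟩ := exists_mem_startVertices G he h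
  have hs := card_startVertices_pos G A
  have hd : (0 : ℝ) < G.degree v := by
    exact_mod_cast G.card_neighborFinset_eq_degree v ▸ Finset.card_pos.2 ⟨u, hu⟩
  have hdm : (G.degree v : ℝ) ≤ G.maxDegree := by exact_mod_cast G.degree_le_maxDegree v
  have hB : B.1 = A.1 ∆ {s(u, v)} := by rw [← h, symmDiff_symmDiff_cancel_left]
  have hK : 1 / ((startVertices G A).card : ℝ) * (1 / (G.degree v : ℝ)) ≤ proposal G A B := by
    have hnn : ∀ v' u', (0 : ℝ) ≤ if B.1 = A.1 ∆ {s(u', v')} then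
        1 / ((startVertices G A).card : ℝ) * (1 / (G.degree v' : ℝ)) else 0 := fun v' u' => by
      split_ifs <;> positivity
    rw [proposal, Matrix.of_apply]
    refine le_trans ?_ (Finset.single_le_sum
      (fun v' _ => Finset.sum_nonneg fun u' _ => hnn v' u') hv)
    refine le_trans ?_ (Finset.single_le_sum (fun u' _ => hnn v u') hu)
    rw [if_pos hB]
  calc (1 : ℝ) = G.degree v * ((startVertices G A).card *
        (1 / ((startVertices G A).card : ℝ) * (1 / (G.degree v : ℝ)))) := by field_simp
    _ ≤ _ := by gcongr

/-- The capacity of a transition of the lazy worm process. -/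
theorem min_weight_le [Nonempty V] {w : ℝ} (hw : 0 < w) (M : Finset (Sym2 V)) {A B : State G}
    {e : Sym2 V} (he : e ∈ G.edgeFinset) (h : A.1 ∆ B.1 = {e}) :
    min (weight w M A.1) (weight w M B.1) ≤
      2 * G.maxDegree * normalizer G w M * (psMeasure G w M A * lazyWorm G w M A B) := by
  have hAB : A ≠ B := by
    rintro rfl
    rw [symmDiff_self] at h
    exact Finset.singleton_ne_empty e h.symm
  have hZ := normalizer_pos G hw M
  have key : ∀ {A B : State G}, A.1 ∆ B.1 = {e} → weight w M A.1 ≤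
      G.maxDegree * normalizer G w M * (psMeasure G w M A * proposal G A B) := by
    intro A B h
    have h1 := mul_le_mul_of_nonneg_left (one_le_maxDegree_mul_proposal G he h)
      (weight_pos hw M A.1).le
    rw [mul_one] at h1
    refine h1.trans_eq ?_
    rw [psMeasure_eq]
    field_simp
  have hc : (0 : ℝ) ≤ G.maxDegree * normalizer G w M := by positivity
  have hP : 2 * G.maxDegree * normalizer G w M * (psMeasure G w M A * lazyWorm G w M A B) =
      G.maxDegree * normalizer G w M * min (psMeasure G w M A * proposal G A B)
        (psMeasure G w M B * proposal G B A) := by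
    rw [lazyWorm, MarkovChain.lazy_apply_of_ne _ hAB,
      ← MarkovChain.mul_metropolis (proposal_nonneg G) (psMeasure_pos G hw M) hAB]
    ring
  rw [hP, mul_min_of_nonneg _ _ hc]
  exact min_le_min (key h) (key (by rwa [symmDiff_comm]))

theorem lazyWorm_pos [Nonempty V] {w : ℝ} (hw : 0 < w) (M : Finset (Sym2 V)) {A B : State G}
    {e : Sym2 V} (he : e ∈ G.edgeFinset) (h : A.1 ∆ B.1 = {e}) : 0 < lazyWorm G w M A B := by
  have h1 := lt_of_lt_of_le (lt_min (weight_pos hw M A.1) (weight_pos hw M B.1))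
    (min_weight_le G hw M he h)
  have hZ := normalizer_pos G hw M
  have h2 := pos_of_mul_pos_right h1 (by positivity)
  exact pos_of_mul_pos_right h2 (psMeasure_pos G hw M A).le

/-! ### Canonical paths and their congestion -/

/-- The canonical paths of the worm process: from `I` to `F`, flip the edges in which they differ
in the order of the unwinding. -/
noncomputable def canonicalPaths [Nonempty V] {w : ℝ} (hw : 0 < w) (M : Finset (Sym2 V)) :
    MarkovChain.CanonicalPaths (lazyWorm G w M) (evenStates G) where
  path I F :=
    { length := (flips I F).length
      toFun := fun i => pathState I F i
      step := fun i => lazyWorm_pos G hw M (flips_getElem_mem I F i.2)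
        (pathState_symmDiff_succ I F i.2) }
  head_eq := pathState_zero
  last_eq := pathState_length
  injective I F i j h := Fin.ext (pathState_injOn I F (Nat.lt_succ_iff.1 i.2)
    (Nat.lt_succ_iff.1 j.2) h)

variable {G}

theorem uses_canonicalPaths [Nonempty V] {w : ℝ} {hw : 0 < w} {M : Finset (Sym2 V)}
    {I : State G} {F : evenStates G} {t : State G × State G}
    (h : MarkovChain.Uses ((canonicalPaths G hw M).path I F) t) :
    ∃ i < (flips I F).length, pathState I F i = t.1 ∧ pathState I F (i + 1) = t.2 := by
  obtain ⟨i, h1, h2⟩ := h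
  exact ⟨i, i.2, h1, h2⟩

/-- A transition together with the difference `I ∆ F` determines `I` and `F`: the flipped edge
gives the position in the unwinding, hence the edges flipped before. -/
theorem eq_of_pathState_eq {I I' : State G} {F F' : evenStates G} {x y : State G} {i j : ℕ}
    (hi : i < (flips I F).length) (hj : j < (flips I' F').length)
    (hD : I.1 ∆ F.1.1 = I'.1 ∆ F'.1.1)
    (hx : pathState I F i = x) (hy : pathState I F (i + 1) = y)
    (hx' : pathState I' F' j = x) (hy' : pathState I' F' (j + 1) = y) : I = I' ∧ F = F' := by
  have hl : flips I F = flips I' F' := congrArg unwinding hD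
  have hi' := pathState_symmDiff_succ I F hi
  have hj' := pathState_symmDiff_succ I' F' hj
  rw [hx, hy] at hi'
  rw [hx', hy', hi', Finset.singleton_inj] at hj'
  have hij : i = j := by
    simp only [hl] at hj'
    exact ((flips_spec I' F').1.getElem_inj_iff).1 hj'
  subst hij
  have hI : I.1 = I'.1 := by
    have h := congrArg Subtype.val (hx.trans hx'.symm)
    rw [pathState_coe, pathState_coe, hl] at h
    exact symmDiff_left_injective _ h
  rw [hI, symmDiff_right_inj] at hD
  exact ⟨Subtype.ext hI, Subtype.ext (Subtype.ext hD)⟩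

theorem boundary_encoding (I x : State G) (F : evenStates G) :
    boundary (I.1 ∆ F.1.1 ∆ x.1) = boundary I.1 ∆ boundary x.1 := by
  rw [boundary_symmDiff, boundary_symmDiff, boundary_even, ← Finset.bot_eq_empty, symmDiff_bot]

theorem mem_sector_of_card_le_four {A : Finset (Sym2 V)} (hA : A ⊆ G.edgeFinset)
    (h : (boundary A).card ≤ 4) : A ∈ sector G 0 ∪ sector G 2 ∪ sector G 4 := by
  rw [Finset.mem_union, mem_states, mem_sector]
  obtain ⟨k, hk⟩ := even_card_boundary G hA
  have : (boundary A).card ≤ 2 ∨ (boundary A).card = 4 := by omega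
  rcases this with h | h
  exacts [Or.inl ⟨hA, h⟩, Or.inr ⟨hA, h⟩]

/-- The encodings `I ∆ F ∆ x` of pairs of states, weighted by the Prokof'ev–Svistunov factor of
`I`. If `I` is even, the encoding has at most two odd vertices, otherwise at most four. -/
theorem sum_card_startVertices_mul_weight_le {w : ℝ} (hw : 0 < w) (M : Finset (Sym2 V))
    (x : State G) {U : Finset (State G × evenStates G)}
    (hU : Set.InjOn (fun p : State G × evenStates G => p.1.1 ∆ p.2.1.1 ∆ x.1) U) :
    ∑ p ∈ U, ((startVertices G p.1).card : ℝ) * weight w M (p.1.1 ∆ p.2.1.1 ∆ x.1) ≤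
      Fintype.card V * (totalWeight w M (sector G 0) + totalWeight w M (sector G 2)) +
        2 * (totalWeight w M (sector G 0) + totalWeight w M (sector G 2) +
          totalWeight w M (sector G 4)) := by
  have hsub : ∀ p : State G × evenStates G, p.1.1 ∆ p.2.1.1 ∆ x.1 ⊆ G.edgeFinset := fun p =>
    symmDiff_subset (symmDiff_subset p.1.subset p.2.1.subset) x.subset
  have h02 : Disjoint (sector G 0) (sector G 2) := disjoint_sector G (by norm_num)
  have h024 : Disjoint (sector G 0 ∪ sector G 2) (sector G 4) :=
    Finset.disjoint_union_left.2 ⟨disjoint_sector G (by norm_num), disjoint_sector G (by norm_num)⟩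
  rw [← Finset.sum_filter_add_sum_filter_not U fun p => p.1.1 ∈ sector G 0]
  rw [← totalWeight_union w M h02, ← totalWeight_union w M h024]
  refine add_le_add ?_ ?_
  · refine le_of_eq_of_le (Finset.sum_congr rfl fun p hp => ?_)
      (le_of_eq_of_le (Finset.mul_sum _ _ _).symm (mul_le_mul_of_nonneg_left
        (sum_weight_le_totalWeight hw M (hU.mono (Finset.filter_subset _ _)) fun p hp => ?_)
        (Nat.cast_nonneg _)))
    · rw [card_startVertices, if_pos (Finset.mem_filter.1 hp).2]
    · refine (mem_states G).2 ⟨hsub p, ?_⟩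
      rw [boundary_encoding, boundary_eq_empty G (Finset.mem_filter.1 hp).2,
        ← Finset.bot_eq_empty, bot_symmDiff]
      exact x.card_boundary_le
  · refine le_of_eq_of_le (Finset.sum_congr rfl fun p hp => ?_)
      (le_of_eq_of_le (Finset.mul_sum _ _ _).symm (mul_le_mul_of_nonneg_left
        (sum_weight_le_totalWeight hw M (hU.mono (Finset.filter_subset _ _)) fun p hp => ?_)
        zero_le_two))
    · rw [card_startVertices, if_neg (Finset.mem_filter.1 hp).2]
    · refine mem_sector_of_card_le_four (hsub p) ?_
      rw [boundary_encoding]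
      have h1 := Finset.card_symmDiff_le (boundary p.1.1) (boundary x.1)
      have h2 := p.1.card_boundary_le
      have h3 := x.card_boundary_le
      omega

open Classical in
/-- The flow through a transition, in terms of an endpoint `x` of the transition. -/
theorem flow_canonicalPaths_le [Nonempty V] {w : ℝ} (hw : 0 < w) (M : Finset (Sym2 V))
    {t : State G × State G} {x : State G} (hx : x = t.1 ∨ x = t.2) :
    (∑ I : State G, ∑ F : evenStates G,
      if MarkovChain.Uses ((canonicalPaths G hw M).path I F) t
        then psMeasure G w M I * psMeasure G w M F else 0) ≤
      Fintype.card V * weight w M x.1 / normalizer G w M ^ 2 *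
        (Fintype.card V * (totalWeight w M (sector G 0) + totalWeight w M (sector G 2)) +
          2 * (totalWeight w M (sector G 0) + totalWeight w M (sector G 2) +
            totalWeight w M (sector G 4))) := by
  set U : Finset (State G × evenStates G) := Finset.univ.filter fun p =>
    MarkovChain.Uses ((canonicalPaths G hw M).path p.1 p.2) t with hUdef
  have hU : ∀ p ∈ U, ∃ i < (flips p.1 p.2).length,
      pathState p.1 p.2 i = t.1 ∧ pathState p.1 p.2 (i + 1) = t.2 := fun p hp =>
    uses_canonicalPaths (Finset.mem_filter.1 hp).2
  have hinj : Set.InjOn (fun p : State G × evenStates G => p.1.1 ∆ p.2.1.1 ∆ x.1) U := by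
    intro p hp q hq h
    obtain ⟨i, hi, hi1, hi2⟩ := hU p hp
    obtain ⟨j, hj, hj1, hj2⟩ := hU q hq
    exact Prod.ext_iff.2
      (eq_of_pathState_eq hi hj (symmDiff_left_injective _ h) hi1 hi2 hj1 hj2)
  have hterm : ∀ p ∈ U, psMeasure G w M p.1 * psMeasure G w M p.2 =
      Fintype.card V * weight w M x.1 / normalizer G w M ^ 2 *
        ((startVertices G p.1).card * weight w M (p.1.1 ∆ p.2.1.1 ∆ x.1)) := by
    intro p hp
    obtain ⟨i, hi, hi1, hi2⟩ := hU p hp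
    obtain ⟨k, hk⟩ : ∃ k, x = pathState p.1 p.2 k := by
      rcases hx with rfl | rfl
      exacts [⟨i, hi1.symm⟩, ⟨i + 1, hi2.symm⟩]
    have hsub : ((flips p.1 p.2).take k).toFinset ⊆ p.1.1 ∆ p.2.1.1 := by
      rw [← (flips_spec p.1 p.2).2.1]
      exact fun e he => List.mem_toFinset.2 (List.mem_of_mem_take (List.mem_toFinset.1 he))
    have hw2 := weight_mul_weight w M hsub
    rw [← pathState_coe, ← hk] at hw2
    rw [psMeasure_eq, psMeasure_evenStates]
    linear_combination ((startVertices G p.1).card * Fintype.card V / normalizer G w M ^ 2 : ℝ)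
      * hw2
  rw [← Fintype.sum_prod_type' (f := fun I F =>
    if MarkovChain.Uses ((canonicalPaths G hw M).path I F) t
      then psMeasure G w M I * psMeasure G w M F else 0), ← Finset.sum_filter, ← hUdef,
    Finset.sum_congr rfl hterm, ← Finset.mul_sum]
  have hZ := normalizer_pos G hw M
  have hwx := weight_pos hw M x.1
  exact mul_le_mul_of_nonneg_left (sum_card_startVertices_mul_weight_le hw M x hinj)
    (by positivity)

/-- The division of the flow `n a T / Z²` by the capacity `c`, which is at least `a / (2 d Z)`. -/
theorem flow_le_of_weight_le {n Z T d a c : ℝ} (hZ : 0 < Z) (hn : 0 ≤ n) (hT : 0 ≤ T)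
    (h : a ≤ 2 * d * Z * c) : n * a / Z ^ 2 * T ≤ n / Z * (2 * d * T) * c := by
  calc n * a / Z ^ 2 * T = n / Z ^ 2 * T * a := by ring
    _ ≤ n / Z ^ 2 * T * (2 * d * Z * c) := by gcongr
    _ = n / Z * (2 * d * T) * c := by field_simp

theorem congestion_canonicalPaths_le [Nonempty V] {w : ℝ} (hw : 0 < w) (M : Finset (Sym2 V))
    {χ₂ χ₄ : ℝ} (hχ : BoundedDefectSusceptibility G w M χ₂ χ₄) :
    (canonicalPaths G hw M).congestion (psMeasure G w M) ≤
      (∑ F ∈ evenStates G, psMeasure G w M F) *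
        (2 * G.maxDegree * ((1 + χ₂) * (2 + Fintype.card V) + 2 * χ₄)) := by
  classical
  have h0 := totalWeight_sector_zero_pos G hw M
  have h2' := totalWeight_nonneg hw M (sector G 2)
  have h4' := totalWeight_nonneg hw M (sector G 4)
  have hZ := normalizer_pos G hw M
  rw [sum_evenStates]
  set n : ℝ := (Fintype.card V : ℝ)
  have hn0 : 0 ≤ n := Nat.cast_nonneg _
  set T : ℝ := n * (totalWeight w M (sector G 0) + totalWeight w M (sector G 2)) +
    2 * (totalWeight w M (sector G 0) + totalWeight w M (sector G 2) +
      totalWeight w M (sector G 4)) with hT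
  have hT0 : 0 ≤ T := by positivity
  have hbound : 0 ≤ n / normalizer G w M * (2 * G.maxDegree * T) := by positivity
  have hnd : 0 ≤ n / normalizer G w M * (2 * G.maxDegree) := by positivity
  have h2 := (div_le_iff₀ h0).1 hχ.1
  have h4 := (div_le_iff₀ h0).1 hχ.2
  have hTle : T ≤ totalWeight w M (sector G 0) * ((1 + χ₂) * (2 + n) + 2 * χ₄) := by
    have := mul_le_mul_of_nonneg_left h2 hn0
    rw [hT]; linarith
  have hmain : n / normalizer G w M * (2 * G.maxDegree * T) ≤
      n * totalWeight w M (sector G 0) / normalizer G w M *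
        (2 * G.maxDegree * ((1 + χ₂) * (2 + n) + 2 * χ₄)) := by
    have h := mul_le_mul_of_nonneg_left hTle hnd
    refine le_trans (le_of_eq ?_) (h.trans_eq ?_) <;> ring
  refine (Real.iSup_le (fun t => ?_) hbound).trans hmain
  have hcap : 0 < psMeasure G w M t.1.1 * lazyWorm G w M t.1.1 t.1.2 :=
    mul_pos (psMeasure_pos G hw M _) t.2
  by_cases hU : ∃ I F, MarkovChain.Uses ((canonicalPaths G hw M).path I F) t.1
  · obtain ⟨I, F, hIF⟩ := hU
    obtain ⟨i, hi, hi1, hi2⟩ := uses_canonicalPaths hIF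
    have hflip := pathState_symmDiff_succ I F hi
    rw [hi1, hi2] at hflip
    have hmin := min_weight_le G hw M (flips_getElem_mem I F hi) hflip
    -- The encoding uses the endpoint of smaller weight, which is the one that the capacity
    -- of the transition controls.
    obtain ⟨x, hx, hxw⟩ : ∃ x, (x = t.1.1 ∨ x = t.1.2) ∧ weight w M x.1 ≤
        2 * G.maxDegree * normalizer G w M *
          (psMeasure G w M t.1.1 * lazyWorm G w M t.1.1 t.1.2) := by
      rcases min_le_iff.1 hmin with h | h
      exacts [⟨_, Or.inl rfl, h⟩, ⟨_, Or.inr rfl, h⟩]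
    rw [inv_mul_eq_div, div_le_iff₀ hcap]
    refine (flow_canonicalPaths_le hw M hx).trans ?_
    exact flow_le_of_weight_le hZ hn0 hT0 hxw
  · push Not at hU
    simp only [hU, if_false, Finset.sum_const_zero, mul_zero]
    exact hbound

theorem congestion_canonicalPaths_nonneg [Nonempty V] {w : ℝ} (hw : 0 < w)
    (M : Finset (Sym2 V)) : 0 ≤ (canonicalPaths G hw M).congestion (psMeasure G w M) := by
  classical
  refine Real.iSup_nonneg fun t => mul_nonneg
    (inv_nonneg.2 (mul_pos (psMeasure_pos G hw M _) t.2).le) ?_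
  refine Finset.sum_nonneg fun I _ => Finset.sum_nonneg fun F _ => ?_
  split_ifs
  exacts [(mul_pos (psMeasure_pos G hw M _) (psMeasure_pos G hw M _)).le, le_rfl]

theorem maxLength_canonicalPaths_le [Nonempty V] {w : ℝ} (hw : 0 < w) (M : Finset (Sym2 V)) :
    (canonicalPaths G hw M).maxLength ≤ G.edgeFinset.card :=
  Finset.sup_le fun p _ => length_flips_le p.1 p.2

theorem two_mul_mul_le {L m φ d v B : ℝ} (hL0 : 0 ≤ L) (hL : L ≤ m) (hφ0 : 0 ≤ φ)
    (hφ : φ ≤ 2 * d * v * B) : 2 * L * φ ≤ 8 * d * v * m * B := by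
  have h1 := mul_le_mul hL hφ hφ0 (hL0.trans hL)
  have h2 := mul_nonneg (hL0.trans hL) (hφ0.trans hφ)
  linarith

end Worm

theorem mainTheorem1 {V : Type*} [Fintype V] [DecidableEq V] [Nonempty V]
    (G : SimpleGraph V) [DecidableRel G.Adj]
    (w : ℝ) (hw₀ : 0 < w) (hw₁ : w < 1)
    (M : Finset (Sym2 V)) (hM : M ⊆ G.edgeFinset)
    (χ₂ χ₄ : ℝ) (hχ : Worm.BoundedDefectSusceptibility G w M χ₂ χ₄) :
    (∃ Γ : MarkovChain.CanonicalPaths (Worm.lazyWorm G w M) (Worm.evenStates G),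
      Γ.maxLength ≤ G.edgeFinset.card ∧
      Γ.congestion (Worm.psMeasure G w M) ≤
        2 * G.maxDegree * w⁻¹ * ((1 + χ₂) * (2 + Fintype.card V) + 2 * χ₄) ∧
      Γ.congestion (Worm.psMeasure G w M) /
          (∑ F ∈ Worm.evenStates G, Worm.psMeasure G w M F) ≤
        2 * G.maxDegree * w⁻¹ * ((1 + χ₂) * (2 + Fintype.card V) + 2 * χ₄)) ∧
    MarkovChain.relaxationTime (Worm.lazyWorm G w M) ≤
      ENNReal.ofReal (8 * G.maxDegree * w⁻¹ * G.edgeFinset.card *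
        ((1 + χ₂) * (2 + Fintype.card V) + 2 * χ₄)) := by
  have hχ₂ : 0 ≤ χ₂ := le_trans (div_nonneg (Worm.totalWeight_nonneg hw₀ M _)
    (Worm.totalWeight_nonneg hw₀ M _)) hχ.1
  have hχ₄ : 0 ≤ χ₄ := le_trans (div_nonneg (Worm.totalWeight_nonneg hw₀ M _)
    (Worm.totalWeight_nonneg hw₀ M _)) hχ.2
  set B : ℝ := (1 + χ₂) * (2 + Fintype.card V) + 2 * χ₄ with hB
  have hB0 : 0 ≤ B := by positivity
  have hdB : 0 ≤ 2 * G.maxDegree * B := by positivity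
  have hπ := Worm.psMeasure_pos G hw₀ M
  have hπ1 := Worm.sum_psMeasure G hw₀ M
  have hφ0 := Worm.congestion_canonicalPaths_nonneg (G := G) hw₀ M
  have hL := Worm.maxLength_canonicalPaths_le (G := G) hw₀ M
  have hS : (Worm.evenStates G).Nonempty :=
    ⟨⟨∅, (Worm.mem_states G).2 (by simp)⟩,
      (Worm.mem_evenStates G).2 ((Worm.mem_sector G).2 (by simp))⟩
  have hSpos : 0 < ∑ F ∈ Worm.evenStates G, Worm.psMeasure G w M F :=
    Finset.sum_pos (fun F _ => hπ F) hS
  have hS1 : ∑ F ∈ Worm.evenStates G, Worm.psMeasure G w M F ≤ 1 :=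
    hπ1 ▸ Finset.sum_le_sum_of_subset_of_nonneg (Finset.subset_univ _) fun F _ _ => (hπ F).le
  have hφ := Worm.congestion_canonicalPaths_le hw₀ M hχ
  rw [← hB] at hφ
  have hwi : 1 ≤ w⁻¹ := (one_le_inv₀ hw₀).2 hw₁.le
  have hw' : 2 * G.maxDegree * B ≤ 2 * G.maxDegree * w⁻¹ * B := by
    have := mul_le_mul_of_nonneg_left hwi hdB
    linarith
  have hnorm : (Worm.canonicalPaths G hw₀ M).congestion (Worm.psMeasure G w M) /
      (∑ F ∈ Worm.evenStates G, Worm.psMeasure G w M F) ≤ 2 * G.maxDegree * w⁻¹ * B :=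
    ((div_le_iff₀' hSpos).2 hφ).trans hw'
  refine ⟨⟨Worm.canonicalPaths G hw₀ M, hL, ?_, hnorm⟩, ?_⟩
  · exact (hφ.trans (mul_le_of_le_one_left hdB hS1)).trans hw'
  · refine (MarkovChain.relaxationTime_lazy_le hπ hπ1 hS
      (MarkovChain.metropolis_nonneg (Worm.proposal_nonneg G) (Worm.sum_proposal_le_one G) hπ)
      (MarkovChain.sum_metropolis _ _)
      (MarkovChain.mul_metropolis_comm (Worm.proposal_nonneg G) hπ)
      (Worm.canonicalPaths G hw₀ M) hφ0).trans (ENNReal.ofReal_le_ofReal ?_)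
    have hL' : ((Worm.canonicalPaths G hw₀ M).maxLength : ℝ) ≤ G.edgeFinset.card := by
      exact_mod_cast hL
    exact Worm.two_mul_mul_le (Nat.cast_nonneg _) hL' (div_nonneg hφ0 hSpos.le) hnorm
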